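/- Let $P$ be the transition matrix of an ergodic (irreducible and aperiodic) Markov chain on a finite state space $S$ with stationary distribution $\mu$, and let $T_{\text{mix}}$ be its mixing time, i.e. the smallest $t\ge 0$ such that $\sup_{A\subseteq S}\lvert P^t(x_0,A)-\mu(A)\rvert\le 1/8$ for every $x_0\in S$. Run $|S|$ simultaneous simulations of the chain, one starting at each state. Whenever two or more simulations are in the same state at the same time, they are merged into a single simulation; the surviving simulations make their steps independently of each other according to $P$. Let $0<\delta\le 1/2$. Then with probability at least $1-\delta$ all $|S|$ simulations have been merged into one after at most $512\,|S|\,T_{\text{mix}}\log(1/\delta)$ steps, where $\log$ is the natural logarithm. -/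

import Mathlib

open scoped Matrix
open MeasureTheory

/-- The transition matrix `P` (with `P x y` the probability of moving from `x` to `y`) of an
ergodic Markov chain on the finite state space `S`: stochastic, irreducible and aperiodic.
Aperiodicity says that for every state the only common divisor of the lengths of its possible
returns is `1`. -/
structure IsErgodicChain {S : Type*} [Fintype S] [DecidableEq S] (P : Matrix S S ℝ) : Prop where
  stochastic : P ∈ Matrix.rowStochastic ℝ S
  irreducible : P.IsIrreducible
  aperiodic : ∀ x : S, ∀ d : ℕ, (∀ n : ℕ, 1 ≤ n → 0 < (P ^ n) x x → d ∣ n) → d = 1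

/-- `μ` is a stationary distribution of the chain with transition matrix `P`. -/
structure IsStationaryDistribution {S : Type*} [Fintype S] (P : Matrix S S ℝ) (μ : S → ℝ) :
    Prop where
  distribution : μ ∈ stdSimplex ℝ S
  stationary : μ ᵥ* P = μ

/-- Total-variation distance `sup_A |p(A) - q(A)|` of two distributions on a finite set. -/
noncomputable def tvDistance {S : Type*} (p q : S → ℝ) : ℝ :=
  ⨆ A : Finset S, |∑ s ∈ A, p s - ∑ s ∈ A, q s|

/-- The mixing time: the smallest `t` such that, from every starting state, the distribution
after `t` steps is within total-variation distance `1/8` of `μ`. -/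
noncomputable def mixingTime {S : Type*} [Fintype S] [DecidableEq S] (P : Matrix S S ℝ)
    (μ : S → ℝ) : ℕ :=
  sInf {t : ℕ | ∀ x : S, tvDistance ((P ^ t) x) μ ≤ 1 / 8}

/-- `X t ω i` is the state at time `t` of the simulation of the chain that was started in the
state `i`, where simulations that meet are merged. There is one simulation per starting state;
simulations that are in the same state at some time stay together; and, given the whole history
`h 0, …, h t` of all the simulations, the surviving (merged) simulations, one for each occupied
state `z`, make their next steps independently of each other, the one at `z` moving to `g z`
with probability `P z (g z)`. -/
structure IsMergingSimulation {S Ω : Type*} [Fintype S] [DecidableEq S] [MeasurableSpace Ω]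
    (P : Matrix S S ℝ) (prob : Measure Ω) (X : ℕ → Ω → S → S) : Prop where
  measurable : ∀ (t : ℕ) (i s : S), MeasurableSet {ω | X t ω i = s}
  start : ∀ (ω : Ω) (i : S), X 0 ω i = i
  merge : ∀ (t : ℕ) (ω : Ω) (i j : S), X t ω i = X t ω j → X (t + 1) ω i = X (t + 1) ω j
  step : ∀ (t : ℕ) (h : ℕ → S → S) (g : S → S),
    prob.real {ω | (∀ s ≤ t, X s ω = h s) ∧ ∀ i, X (t + 1) ω i = g (h t i)} =
      prob.real {ω | ∀ s ≤ t, X s ω = h s} * ∏ z ∈ Finset.univ.image (h t), P z (g z)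

/-! Watch the chain in blocks of `T = mixingTime P μ` steps and let `k` be the number of occupied
states, `n = |S|`. Merging walks avoid a given site `x` with at least the probability of independent
ones (`avoidance_succ_le`), so the expected number of occupied sites after a block is at most that
for `k` independent walks. Their laws are all within 1/8 of `μ`; splitting the walks into two
halves, the overlap of the halves costs at least `(k-1)^2 / (16 n)` sites (`sum_one_sub_prod_le`).
Hence `w = E[k - 1]` loses at least `E[(k-1)^2] / (16 n)` per block, which dominates both `w^2 / (16
n)` (Jensen) and `w / (16 n)` (integrality). The quadratic loss brings `w` below 1 within `16 n`
blocks, whatever its initial value; the linear loss then gives exponential decay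
(`le_exp_of_quadratic_decay`). Markov's inequality finishes. -/

lemma tvDistance_le_sum_abs {S : Type*} [Fintype S] (p q : S → ℝ) : tvDistance p q ≤ ∑ s, |p s - q s| := by
  refine ciSup_le fun A => ?_
  rw [← Finset.sum_sub_distrib]
  exact (Finset.abs_sum_le_sum_abs _ _).trans
    (Finset.sum_le_sum_of_subset_of_nonneg (Finset.subset_univ _) fun _ _ _ => abs_nonneg _)

lemma sum_posPart_le_tvDistance {S : Type*} [Fintype S] (p q : S → ℝ) : ∑ s, max (q s - p s) 0 ≤ tvDistance p q := by
  have hbdd : BddAbove (Set.range fun A : Finset S => |∑ s ∈ A, p s - ∑ s ∈ A, q s|) :=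
    (Set.finite_range _).bddAbove
  refine le_trans ?_ (le_ciSup hbdd (Finset.univ.filter fun s => p s ≤ q s))
  rw [abs_sub_comm]
  refine le_trans (le_of_eq ?_) (le_abs_self _)
  rw [← Finset.sum_sub_distrib, Finset.sum_filter]
  refine Finset.sum_congr rfl fun s _ => ?_
  split_ifs with h
  · exact max_eq_left (by linarith)
  · exact max_eq_right (by linarith)

/-! ### Convergence to stationarity. -/

section Mixing

variable {S : Type*} [Fintype S] [DecidableEq S]

/-- The possible return times form an additive submonoid of `ℕ` with gcd 1, and such a submonoid
contains all large integers. -/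
lemma IsErgodicChain.eventually_pow_diag_pos {P : Matrix S S ℝ} (hP : IsErgodicChain P) (x : S) :
    ∃ N : ℕ, ∀ m ≥ N, 0 < (P ^ m) x x := by
  have hnn : ∀ k i j, 0 ≤ (P ^ k) i j := fun k i j =>
    Matrix.nonneg_of_mem_rowStochastic (pow_mem hP.stochastic k)
  let M : AddSubmonoid ℕ :=
    { carrier := {n | 0 < (P ^ n) x x}
      zero_mem' := by simp
      add_mem' := by
        intro a b ha hb
        simp only [Set.mem_ofPred_eq] at ha hb ⊢
        rw [pow_add, Matrix.mul_apply]
        exact Finset.sum_pos' (fun z _ => mul_nonneg (hnn _ _ _) (hnn _ _ _))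
          ⟨x, Finset.mem_univ x, mul_pos ha hb⟩ }
  obtain ⟨N, hN⟩ := Nat.exists_mem_closure_of_ge (M : Set ℕ)
  have hgcd : Nat.setGcd (M : Set ℕ) = 1 :=
    hP.aperiodic x _ fun n _ hn => Nat.setGcd_dvd_of_mem hn
  refine ⟨N, fun m hm => ?_⟩
  have := hN m hm (by simp [hgcd])
  rw [AddSubmonoid.closure_eq] at this
  exact this

lemma IsErgodicChain.exists_pow_pos {P : Matrix S S ℝ} (hP : IsErgodicChain P) :
    ∃ N : ℕ, ∀ x y, 0 < (P ^ N) x y := by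
  have hnn : ∀ k i j, 0 ≤ (P ^ k) i j := fun k i j =>
    Matrix.nonneg_of_mem_rowStochastic (pow_mem hP.stochastic k)
  choose N hN using hP.eventually_pow_diag_pos
  have hirr := (Matrix.isIrreducible_iff_exists_pow_pos hP.irreducible.nonneg).1 hP.irreducible
  choose k _ hk using hirr
  let M := Finset.univ.sup fun p : S × S => N p.1 + k p.1 p.2
  refine ⟨M, fun x y => ?_⟩
  have hle : N x + k x y ≤ M :=
    Finset.le_sup (f := fun p : S × S => N p.1 + k p.1 p.2) (Finset.mem_univ (x, y))
  have : M = (M - k x y) + k x y := by omega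
  rw [this, pow_add, Matrix.mul_apply]
  exact Finset.sum_pos' (fun z _ => mul_nonneg (hnn _ _ _) (hnn _ _ _))
    ⟨x, Finset.mem_univ x, mul_pos (hN x _ (by omega)) (hk x y)⟩

/-- Doeblin's contraction: as `v` has total mass zero, subtracting `ε` from every entry of `A` does
not change `v ᵥ* A`, and what remains is nonnegative with row sums `1 - |S| ε`. -/
lemma sum_abs_vecMul_le {A : Matrix S S ℝ} (hA : A ∈ Matrix.rowStochastic ℝ S) {ε : ℝ}
    (hε : ∀ x y, ε ≤ A x y) {v : S → ℝ} (hv : ∑ x, v x = 0) :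
    ∑ y, |(v ᵥ* A) y| ≤ (1 - Fintype.card S * ε) * ∑ x, |v x| := by
  have h1 : ∀ y, |(v ᵥ* A) y| ≤ ∑ x, |v x| * (A x y - ε) := by
    intro y
    have : (v ᵥ* A) y = ∑ x, v x * (A x y - ε) := by
      simp only [mul_sub, Finset.sum_sub_distrib, ← Finset.sum_mul, hv, Matrix.vecMul, dotProduct]
      ring
    rw [this]
    refine (Finset.abs_sum_le_sum_abs _ _).trans (Finset.sum_le_sum fun x _ => ?_)
    rw [abs_mul, abs_of_nonneg (sub_nonneg.2 (hε x y))]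
  refine (Finset.sum_le_sum fun y _ => h1 y).trans (le_of_eq ?_)
  rw [Finset.sum_comm, Finset.mul_sum]
  refine Finset.sum_congr rfl fun x _ => ?_
  rw [← Finset.mul_sum, Finset.sum_sub_distrib, Matrix.sum_row_of_mem_rowStochastic hA]
  simp [mul_comm]

lemma vecMul_pow_eq_self {P : Matrix S S ℝ} {μ : S → ℝ} (h : μ ᵥ* P = μ) (t : ℕ) :
    μ ᵥ* P ^ t = μ := by
  induction t with
  | zero => simp
  | succ t ih => rw [pow_succ, ← Matrix.vecMul_vecMul, ih, h]

/-- Convergence theorem for finite ergodic chains. -/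
lemma IsErgodicChain.exists_tvDistance_le [Nonempty S] {P : Matrix S S ℝ} (hP : IsErgodicChain P)
    {μ : S → ℝ} (hμ : IsStationaryDistribution P μ) {η : ℝ} (hη : 0 < η) :
    ∃ t : ℕ, ∀ x : S, tvDistance ((P ^ t) x) μ ≤ η := by
  obtain ⟨N, hN⟩ := hP.exists_pow_pos
  obtain ⟨p, -, hp⟩ := Finset.exists_min_image (Finset.univ : Finset (S × S))
    (fun p => (P ^ N) p.1 p.2) Finset.univ_nonempty
  set ε := (P ^ N) p.1 p.2
  have hε : 0 < ε := hN _ _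
  have hεle : ∀ x y, ε ≤ (P ^ N) x y := fun x y => hp (x, y) (Finset.mem_univ _)
  have hst := pow_mem hP.stochastic N
  set c : ℝ := 1 - Fintype.card S * ε with hc
  have hc1 : c < 1 := by
    have : (0 : ℝ) < Fintype.card S := by exact_mod_cast Fintype.card_pos
    have := mul_pos this hε
    linarith
  have hc0 : 0 ≤ c := by
    obtain ⟨x⟩ := ‹Nonempty S›
    have := Matrix.sum_row_of_mem_rowStochastic hst x
    have h2 : ∑ _y : S, ε ≤ ∑ y, (P ^ N) x y := Finset.sum_le_sum fun y _ => hεle x y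
    simp only [Finset.sum_const, Finset.card_univ, nsmul_eq_mul] at h2
    linarith
  obtain ⟨hμ0, hμ1⟩ := hμ.distribution
  have key : ∀ (m : ℕ) (x : S), ∑ y, |(P ^ (N * m)) x y - μ y| ≤ c ^ m * 2 := by
    intro m x
    induction m with
    | zero =>
      simp only [mul_zero, pow_zero, one_mul]
      calc ∑ y, |(1 : Matrix S S ℝ) x y - μ y| ≤ ∑ y, ((1 : Matrix S S ℝ) x y + μ y) := by
            refine Finset.sum_le_sum fun y _ => ?_
            refine (abs_sub _ _).trans (le_of_eq ?_)
            rw [abs_of_nonneg (hμ0 y), abs_of_nonneg]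
            rw [Matrix.one_apply]; split_ifs <;> norm_num
        _ = 2 := by
            rw [Finset.sum_add_distrib, hμ1]
            simp [Matrix.one_apply]; norm_num
    | succ m ih =>
      have hsum : ∑ y, ((P ^ (N * m)) x y - μ y) = 0 := by
        rw [Finset.sum_sub_distrib, hμ1,
          Matrix.sum_row_of_mem_rowStochastic (pow_mem hP.stochastic _), sub_self]
      have heq : ∀ y, (P ^ (N * (m + 1))) x y - μ y =
          ((fun y => (P ^ (N * m)) x y - μ y) ᵥ* P ^ N) y := by
        intro y
        have h1 : ((fun y => (P ^ (N * m)) x y - μ y) ᵥ* P ^ N) =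
            (P ^ (N * m)) x ᵥ* P ^ N - μ ᵥ* P ^ N := by
          rw [← Matrix.sub_vecMul]; rfl
        rw [h1, vecMul_pow_eq_self hμ.stationary, mul_add, mul_one, pow_add]
        rfl
      simp only [heq]
      refine (sum_abs_vecMul_le hst hεle hsum).trans ?_
      rw [pow_succ']
      rw [mul_assoc]
      exact mul_le_mul_of_nonneg_left ih hc0
  obtain ⟨m, hm⟩ := exists_pow_lt_of_lt_one (half_pos hη) hc1
  exact ⟨N * m, fun x => (tvDistance_le_sum_abs _ _).trans ((key m x).trans (by linarith))⟩

/-- The infimum of an empty set in `ℕ` is 0, so convergence is needed here; this is the only use of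
irreducibility and aperiodicity. -/
lemma IsErgodicChain.tvDistance_mixingTime_le [Nonempty S] {P : Matrix S S ℝ}
    (hP : IsErgodicChain P) {μ : S → ℝ} (hμ : IsStationaryDistribution P μ) (x : S) :
    tvDistance ((P ^ mixingTime P μ) x) μ ≤ 1 / 8 :=
  Nat.sInf_mem (s := {t : ℕ | ∀ x : S, tvDistance ((P ^ t) x) μ ≤ 1 / 8})
    (hP.exists_tvDistance_le hμ (by norm_num)) x

end Mixing

/-! ### Sites occupied by independent points. -/

section Occupancy

/-- A union bound for two independent events, improved by the tangent of their overlap. -/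
lemma one_sub_mul_le_of_one_sub_le {a b u v c m : ℝ} (hu : 0 ≤ u) (hua : 1 - a ≤ u)
    (hv : 0 ≤ v) (hvb : 1 - b ≤ v) (hma : m ≤ a) (hmb : m ≤ b) (ha : 0 ≤ a) (hb : 0 ≤ b)
    (hc : 0 ≤ c) (hc' : c ≤ 1 / 2) : 1 - u * v ≤ a + b - (2 * c * m - c ^ 2) := by
  have h2 : 2 * c * m ≤ 2 * c * a := by gcongr
  have h3 : 2 * c * m ≤ 2 * c * b := by gcongr
  have huv : 0 ≤ u * v := mul_nonneg hu hv
  rcases le_total a 1 with h1 | h1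
  -- If `a, b ≤ 1`, the overlap `a * b` is at least `min a b ^ 2`, which lies above its tangent at
  -- `c`. Otherwise `1 - u * v ≤ 1` suffices, with `c ≤ 1 / 2` absorbing `2 * c * m`.
  · rcases le_total b 1 with h4 | h4
    · have h5 : (1 - a) * (1 - b) ≤ u * v := mul_le_mul hua hvb (by linarith) hu
      rcases le_total a b with h | h
      · nlinarith [sq_nonneg (a - c)]
      · nlinarith [sq_nonneg (b - c)]
    · nlinarith
  · rcases le_total b 1 with h4 | h4
    · nlinarith
    · nlinarith

variable {S : Type*}

lemma one_sub_sum_le_prod_one_sub (A : Finset S) {f : S → ℝ} (h0 : ∀ z, 0 ≤ f z)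
    (h1 : ∀ z, f z ≤ 1) : 1 - ∑ z ∈ A, f z ≤ ∏ z ∈ A, (1 - f z) := by
  classical
  induction A using Finset.induction_on with
  | empty => simp
  | insert z A hz ih =>
    rw [Finset.sum_insert hz, Finset.prod_insert hz]
    have h2 : ∏ z ∈ A, (1 - f z) ≤ 1 :=
      Finset.prod_le_one (fun z _ => sub_nonneg.2 (h1 z)) fun z _ => by linarith [h0 z]
    nlinarith [h0 z]

lemma card_mul_sub_sum_posPart_le (A : Finset S) (f : S → ℝ) (m : ℝ) :
    A.card * m - ∑ z ∈ A, max (m - f z) 0 ≤ ∑ z ∈ A, f z := by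
  rw [← nsmul_eq_mul, ← Finset.sum_const, ← Finset.sum_sub_distrib]
  exact Finset.sum_le_sum fun z _ => by linarith [le_max_left (m - f z) 0]

/-- Independent points whose laws are all close to a common law `μ` on `S` occupy, on average,
noticeably fewer sites than there are points. -/
lemma sum_one_sub_prod_le [Fintype S] {p : S → S → ℝ} {μ : S → ℝ}
    (h0 : ∀ z x, 0 ≤ p z x) (h1 : ∀ z x, p z x ≤ 1) (hp : ∀ z, ∑ x, p z x = 1)
    (hμ0 : ∀ x, 0 ≤ μ x) (hμ : ∑ x, μ x = 1)
    (hclose : ∀ z, ∑ x, max (μ x - p z x) 0 ≤ 1 / 8) (O : Finset S) (hO : O.Nonempty) :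
    ∑ x, (1 - ∏ z ∈ O, (1 - p z x)) ≤
      O.card - ((O.card : ℝ) - 1) ^ 2 / (16 * Fintype.card S) := by
  classical
  obtain ⟨A, hAO, hA⟩ := Finset.exists_subset_card_eq (s := O) (n := O.card / 2) (by omega)
  set k := O.card with hk
  have hk1 : 1 ≤ k := hO.card_pos
  set j := k / 2 with hj
  have hB : (O \ A).card = k - j := by rw [Finset.card_sdiff_of_subset hAO, hA]
  have hjB : (j : ℝ) ≤ ((O \ A).card : ℝ) := by rw [hB]; exact_mod_cast (by omega : j ≤ k - j)
  set n : ℝ := (Fintype.card S : ℝ) with hn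
  have hkn : (k : ℝ) ≤ n := Nat.cast_le.2 (Finset.card_le_univ O)
  have hk1' : (1 : ℝ) ≤ k := by exact_mod_cast hk1
  have hn0 : 0 < n := by linarith
  -- A lower bound for the mean of `m` below when `k ≥ 2`, so the tangent to the square at `c` gains
  -- `n * c ^ 2` in total. The tangent replaces `m x ^ 2` because `m x` may be negative.
  set c : ℝ := (k - 1) / (4 * n) with hc
  have hc0 : 0 ≤ c := div_nonneg (by linarith) (by linarith)
  have hc1 : c ≤ 1 / 2 := by
    rw [hc, div_le_iff₀ (by linarith)]; linarith
  set m : S → ℝ := fun x => j * μ x - ∑ z ∈ O, max (μ x - p z x) 0 with hm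
  have hsub : ∀ (B : Finset S), B ⊆ O → (j : ℝ) ≤ B.card → ∀ x, m x ≤ ∑ z ∈ B, p z x := by
    intro B hBO hjB x
    refine le_trans ?_ (card_mul_sub_sum_posPart_le B (fun z => p z x) (μ x))
    have e1 : ∑ z ∈ B, max (μ x - p z x) 0 ≤ ∑ z ∈ O, max (μ x - p z x) 0 :=
      Finset.sum_le_sum_of_subset_of_nonneg hBO fun _ _ _ => le_max_right _ _
    have e2 := mul_le_mul_of_nonneg_right hjB (hμ0 x)
    simp only [hm]
    linarith
  have hpt : ∀ x, 1 - ∏ z ∈ O, (1 - p z x) ≤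
      ∑ z ∈ O, p z x - (2 * c * m x - c ^ 2) := by
    intro x
    rw [← Finset.prod_sdiff hAO, ← Finset.sum_sdiff hAO]
    exact one_sub_mul_le_of_one_sub_le
      (Finset.prod_nonneg fun z _ => sub_nonneg.2 (h1 z x))
      (one_sub_sum_le_prod_one_sub _ (fun z => h0 z x) fun z => h1 z x)
      (Finset.prod_nonneg fun z _ => sub_nonneg.2 (h1 z x))
      (one_sub_sum_le_prod_one_sub _ (fun z => h0 z x) fun z => h1 z x)
      (hsub _ Finset.sdiff_subset hjB x) (hsub _ hAO (by rw [hA]) x)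
      (Finset.sum_nonneg fun z _ => h0 z x) (Finset.sum_nonneg fun z _ => h0 z x) hc0 hc1
  have hmsum : (j : ℝ) - k / 8 ≤ ∑ x, m x := by
    simp only [hm, Finset.sum_sub_distrib, ← Finset.mul_sum, hμ, mul_one]
    rw [Finset.sum_comm]
    have := Finset.sum_le_sum fun z (_ : z ∈ O) => hclose z
    rw [Finset.sum_const, nsmul_eq_mul] at this
    linarith
  have hcm : c * ((k - 1) / 4) ≤ c * ∑ x, m x := by
    -- For `k = 1` the bound on `∑ m` is too weak, but `c = 0`.
    rcases hk1.eq_or_lt with h | h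
    · simp [hc, ← h]
    · refine mul_le_mul_of_nonneg_left (le_trans ?_ hmsum) hc0
      have e1 : (k : ℝ) ≤ 2 * j + 1 := by exact_mod_cast (by omega : k ≤ 2 * j + 1)
      have e2 : (2 : ℝ) ≤ k := by exact_mod_cast h
      linarith
  refine (Finset.sum_le_sum fun x _ => hpt x).trans ?_
  rw [Finset.sum_sub_distrib, Finset.sum_comm]
  simp only [hp, Finset.sum_const, Finset.sum_sub_distrib, ← Finset.mul_sum, nsmul_eq_mul,
    mul_one, Finset.card_univ]
  have e3 : ((k : ℝ) - 1) ^ 2 / (16 * n) = 2 * (c * ((k - 1) / 4)) - n * c ^ 2 := by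
    rw [hc]; field_simp; ring
  rw [e3]
  linarith

end Occupancy

/-! ### A recursive inequality. -/

section Sequence

/-- A nonnegative sequence decreasing by `w ^ 2 / a` and by `w / a` in each step is at most `1`
after `a` steps and decays exponentially from then on. -/
lemma le_exp_of_quadratic_decay {w : ℕ → ℝ} {a : ℕ} (ha : 0 < a) (hw : ∀ r, 0 ≤ w r)
    (hsq : ∀ r, w (r + 1) ≤ w r - w r ^ 2 / a) (hlin : ∀ r, w (r + 1) ≤ w r - w r / a) (m : ℕ) :
    w (a + m) ≤ Real.exp (-(m / a)) := by
  have ha' : (0 : ℝ) < a := by exact_mod_cast ha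
  -- Discrete form of `y' = -y^2`, whose solutions stay below `1 / r`.
  have h1 : ∀ r : ℕ, r * (w r / a) ≤ 1 := by
    intro r
    induction r with
    | zero => simp
    | succ r ih =>
      have h2 : w (r + 1) / a ≤ w r / a - (w r / a) ^ 2 := by
        rw [div_le_iff₀ ha']
        refine (hsq r).trans (le_of_eq ?_)
        field_simp
      have hy : 0 ≤ w r / a := div_nonneg (hw r) ha'.le
      have hy' : 0 ≤ w (r + 1) / a := div_nonneg (hw _) ha'.le
      set y := w r / a
      have hr : (0 : ℝ) ≤ r := Nat.cast_nonneg r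
      have hy1 : y ≤ 1 := by
        by_contra h
        nlinarith
      push_cast
      nlinarith
  induction m with
  | zero =>
    have := h1 a
    rw [mul_div_cancel₀ _ ha'.ne'] at this
    simpa using this
  | succ m ih =>
    have h2 := hlin (a + m)
    have h3 : 1 - 1 / (a : ℝ) ≤ Real.exp (-(1 / a)) := by
      have := Real.add_one_le_exp (-(1 / (a : ℝ)))
      linarith
    have h4 : w (a + m) * (1 - 1 / (a : ℝ)) ≤ w (a + m) * Real.exp (-(1 / a)) :=
      mul_le_mul_of_nonneg_left h3 (hw _)
    have h5 : w (a + m) * Real.exp (-(1 / (a : ℝ))) ≤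
        Real.exp (-(m / a)) * Real.exp (-(1 / a)) :=
      mul_le_mul_of_nonneg_right ih (Real.exp_pos _).le
    rw [← Real.exp_add] at h5
    have h6 : -((m : ℝ) / a) + -(1 / (a : ℝ)) = -(((m + 1 : ℕ) : ℝ) / a) := by
      push_cast; ring
    rw [h6] at h5
    have h7 : w (a + m) * (1 - 1 / (a : ℝ)) = w (a + m) - w (a + m) / a := by ring
    rw [← add_assoc]
    linarith

end Sequence

/-- Points with the same image give repeated factors in `[0, 1]`; keeping only one of them can only
increase the product. This is where merging is compared with independence. -/
lemma prod_le_prod_image {S : Type*} [DecidableEq S] (s : Finset S) (g : S → S) {f : S → ℝ} (h0 : ∀ y, 0 ≤ f y)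
    (h1 : ∀ y, f y ≤ 1) : ∏ z ∈ s, f (g z) ≤ ∏ y ∈ s.image g, f y := by
  rw [← Finset.prod_fiberwise_of_maps_to (t := s.image g) (g := g)
    fun z hz => Finset.mem_image_of_mem g hz]
  refine Finset.prod_le_prod (fun y _ => Finset.prod_nonneg fun _ _ => h0 _) fun y hy => ?_
  obtain ⟨z, hz, hzy⟩ := Finset.mem_image.1 hy
  rw [Finset.prod_congr rfl fun z hz => by rw [(Finset.mem_filter.1 hz).2], Finset.prod_const]
  exact pow_le_of_le_one (h0 y) (h1 y)
    (Finset.card_pos.2 ⟨z, Finset.mem_filter.2 ⟨hz, hzy⟩⟩).ne'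

/-! ### Merging walks against independent walks. -/

section MergingStep

variable {S : Type*} [Fintype S] [DecidableEq S]

/-- The transition operator of the merging simulation: from the configuration `h` the next
configuration is `g ∘ h`, with `g z` distributed according to the row `P z`, independently over
the states `z`. -/
noncomputable def mergingStep (P : Matrix S S ℝ) (φ : (S → S) → ℝ) (h : S → S) : ℝ :=
  ∑ g : S → S, (∏ z, P z (g z)) * φ (g ∘ h)

/-- The probability that independent walks from the states occupied in `h` all avoid `x` at
time `s`. -/
noncomputable def avoidance (P : Matrix S S ℝ) (s : ℕ) (x : S) (h : S → S) : ℝ :=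
  ∏ z ∈ Finset.univ.image h, (1 - (P ^ s) z x)

lemma mergingStep_mono {P : Matrix S S ℝ} (hP : ∀ x y, 0 ≤ P x y) :
    Monotone (mergingStep P) := fun _ _ hle _ =>
  Finset.sum_le_sum fun _ _ =>
    mul_le_mul_of_nonneg_left (hle _) (Finset.prod_nonneg fun _ _ => hP _ _)

/-- Averaging over one independent step gives the left side exactly; merging then drops repeated
factors. -/
lemma avoidance_succ_le {P : Matrix S S ℝ} (hP : P ∈ Matrix.rowStochastic ℝ S) (s : ℕ) (x : S) :
    avoidance P (s + 1) x ≤ mergingStep P (avoidance P s x) := by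
  intro h
  have hPs := pow_mem hP s
  set O := Finset.univ.image h
  have key : ∀ z, ∑ y, P z y * (if z ∈ O then 1 - (P ^ s) y x else 1) =
      if z ∈ O then 1 - (P ^ (s + 1)) z x else 1 := by
    intro z
    split_ifs
    · rw [pow_succ', Matrix.mul_apply]
      simp only [mul_sub, mul_one, Finset.sum_sub_distrib]
      rw [Matrix.sum_row_of_mem_rowStochastic hP]
    · simp [Matrix.sum_row_of_mem_rowStochastic hP]
  calc avoidance P (s + 1) x h
      = ∏ z, (if z ∈ O then 1 - (P ^ (s + 1)) z x else 1) := by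
        rw [Finset.prod_ite_mem, Finset.univ_inter]; rfl
    _ = ∏ z, ∑ y, P z y * (if z ∈ O then 1 - (P ^ s) y x else 1) := by simp only [key]
    _ = ∑ g : S → S, ∏ z, (P z (g z) * (if z ∈ O then 1 - (P ^ s) (g z) x else 1)) := by
        rw [Finset.prod_univ_sum, Fintype.piFinset_univ]
    _ ≤ mergingStep P (avoidance P s x) h := by
        refine Finset.sum_le_sum fun g _ => ?_
        rw [Finset.prod_mul_distrib, Finset.prod_ite_mem, Finset.univ_inter]
        refine mul_le_mul_of_nonneg_left ?_
          (Finset.prod_nonneg fun _ _ => Matrix.nonneg_of_mem_rowStochastic hP)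
        rw [avoidance, ← Finset.image_image]
        exact prod_le_prod_image O g (f := fun y => 1 - (P ^ s) y x)
          (fun y => sub_nonneg.2 (Matrix.le_one_of_mem_rowStochastic hPs))
          fun y => sub_le_self _ (Matrix.nonneg_of_mem_rowStochastic hPs)

lemma avoidance_le_mergingStep_iterate {P : Matrix S S ℝ} (hP : P ∈ Matrix.rowStochastic ℝ S)
    (s : ℕ) (x : S) : avoidance P s x ≤ (mergingStep P)^[s] (avoidance P 0 x) := by
  induction s with
  | zero => exact le_rfl
  | succ s ih =>
    rw [Function.iterate_succ_apply']
    exact (avoidance_succ_le hP s x).trans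
      (mergingStep_mono (fun _ _ => Matrix.nonneg_of_mem_rowStochastic hP) ih)

lemma sum_one_sub_avoidance_zero (P : Matrix S S ℝ) (h : S → S) :
    ∑ x, (1 - avoidance P 0 x h) = (Finset.univ.image h).card := by
  have key : ∀ x, 1 - avoidance P 0 x h = if x ∈ Finset.univ.image h then 1 else 0 := by
    intro x
    split_ifs with hx
    · rw [avoidance, Finset.prod_eq_zero hx (by simp), sub_zero]
    · rw [avoidance, Finset.prod_eq_one, sub_self]
      intro z hz
      have : z ≠ x := fun e => hx (e ▸ hz)
      simp [Matrix.one_apply_ne this]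
  simp only [key, Finset.sum_ite_mem, Finset.univ_inter, Finset.sum_const, nsmul_eq_mul, mul_one]

/-- Moves at unoccupied states are fictitious: their rows sum to 1. -/
lemma sum_prod_filter_comp_eq {P : Matrix S S ℝ} (hP : P ∈ Matrix.rowStochastic ℝ S)
    (h g₀ : S → S) :
    ∑ g : S → S with g ∘ h = g₀ ∘ h, ∏ z, P z (g z) =
      ∏ z ∈ Finset.univ.image h, P z (g₀ z) := by
  have hfil : (Finset.univ.filter fun g : S → S => g ∘ h = g₀ ∘ h) =
      Fintype.piFinset fun z => if z ∈ Finset.univ.image h then {g₀ z} else Finset.univ := by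
    ext g
    simp only [Finset.mem_filter, Finset.mem_univ, true_and, Fintype.mem_piFinset]
    constructor
    · intro hg z
      split_ifs with hz
      · obtain ⟨i, -, rfl⟩ := Finset.mem_image.1 hz
        exact Finset.mem_singleton.2 (congrFun hg i)
      · exact Finset.mem_univ _
    · intro hg
      funext i
      have := hg (h i)
      rw [if_pos (Finset.mem_image_of_mem h (Finset.mem_univ i))] at this
      exact Finset.mem_singleton.1 this
  rw [hfil]
  refine (Finset.prod_univ_sum _ fun z y => P z y).symm.trans ?_
  rw [← Finset.univ_inter (Finset.univ.image h), ← Finset.prod_ite_mem]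
  refine Finset.prod_congr rfl fun z _ => ?_
  rw [Finset.univ_inter]
  split_ifs
  · simp
  · exact Matrix.sum_row_of_mem_rowStochastic hP z

end MergingStep

/-! ### Decay of the expected number of missing mergers. -/

namespace IsMergingSimulation

variable {S Ω : Type*} [Fintype S] [DecidableEq S] [MeasurableSpace Ω] {P : Matrix S S ℝ}
  {prob : Measure Ω} {X : ℕ → Ω → S → S}

/-- The expectation of `φ` under the distribution of the configuration at time `t`. -/
noncomputable def expect (prob : Measure Ω) (X : ℕ → Ω → S → S) (t : ℕ) (φ : (S → S) → ℝ) : ℝ :=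
  ∑ h : S → S, prob.real {ω | X t ω = h} * φ h

lemma expect_mono (t : ℕ) : Monotone (expect prob X t) := fun _ _ hle =>
  Finset.sum_le_sum fun _ _ => mul_le_mul_of_nonneg_left (hle _) measureReal_nonneg

lemma measurableSet_eq (hX : IsMergingSimulation P prob X) (t : ℕ) (h : S → S) :
    MeasurableSet {ω | X t ω = h} := by
  have : {ω | X t ω = h} = ⋂ i, {ω | X t ω i = h i} := by
    ext ω; simp [funext_iff]
  rw [this]
  exact MeasurableSet.iInter fun i => hX.measurable t i (h i)

/-- The expected number of mergers that are still missing at time `t`. -/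
noncomputable def excess (prob : Measure Ω) (X : ℕ → Ω → S → S) (t : ℕ) : ℝ :=
  expect prob X t fun h => ((Finset.univ.image h).card : ℝ) - 1

lemma one_le_card_image [Nonempty S] (h : S → S) : (1 : ℝ) ≤ (Finset.univ.image h).card := by
  exact_mod_cast (Finset.univ_nonempty.image h).card_pos

lemma excess_nonneg [Nonempty S] (t : ℕ) : 0 ≤ excess prob X t :=
  Finset.sum_nonneg fun h _ =>
    mul_nonneg measureReal_nonneg (sub_nonneg.2 (one_le_card_image h))

lemma excess_le_expect_sq [Nonempty S] (t : ℕ) : excess prob X t ≤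
    expect prob X t fun h => (((Finset.univ.image h).card : ℝ) - 1) ^ 2 := by
  refine expect_mono t fun h => ?_
  have h1 : 1 ≤ (Finset.univ.image h).card := (Finset.univ_nonempty.image h).card_pos
  obtain ⟨m, hm⟩ := Nat.exists_eq_add_of_le h1
  simp only [hm]
  push_cast
  rw [add_sub_cancel_left]
  exact_mod_cast Nat.le_self_pow two_ne_zero m

variable [IsProbabilityMeasure prob]

lemma sum_real_inter_eq (hX : IsMergingSimulation P prob X) (t : ℕ) (B : Set Ω) :
    ∑ h : S → S, prob.real ({ω | X t ω = h} ∩ B) = prob.real B := by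
  have h1 := sum_measureReal_preimage_singleton (μ := prob.restrict B) Finset.univ (f := X t)
    fun h _ => hX.measurableSet_eq t h
  rw [Finset.coe_univ, Set.preimage_univ, measureReal_restrict_apply_univ] at h1
  rw [← h1]
  exact Finset.sum_congr rfl fun h _ =>
    (measureReal_restrict_apply (hX.measurableSet_eq t h)).symm

lemma sum_real_eq (hX : IsMergingSimulation P prob X) (t : ℕ) :
    ∑ h : S → S, prob.real {ω | X t ω = h} = 1 := by
  simpa using hX.sum_real_inter_eq t Set.univ

/-- The step rule, with the history before time `t` summed out. -/
lemma real_step (hX : IsMergingSimulation P prob X) (t : ℕ) (h g : S → S) :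
    prob.real {ω | X t ω = h ∧ X (t + 1) ω = g ∘ h} =
      prob.real {ω | X t ω = h} * ∏ z ∈ Finset.univ.image h, P z (g z) := by
  let Y : Ω → Fin t → S → S := fun ω s => X s ω
  have hY : ∀ c, MeasurableSet (Y ⁻¹' {c}) := by
    intro c
    have : Y ⁻¹' {c} = ⋂ s : Fin t, {ω | X s ω = c s} := by
      ext ω; simp [Y, funext_iff]
    rw [this]
    exact MeasurableSet.iInter fun s => hX.measurableSet_eq s (c s)
  have hsum : ∀ B : Set Ω, ∑ c, prob.real (Y ⁻¹' {c} ∩ B) = prob.real B := by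
    intro B
    have h1 := sum_measureReal_preimage_singleton (μ := prob.restrict B) Finset.univ (f := Y)
      fun c _ => hY c
    rw [Finset.coe_univ, Set.preimage_univ, measureReal_restrict_apply_univ] at h1
    rw [← h1]
    exact Finset.sum_congr rfl fun c _ => (measureReal_restrict_apply (hY c)).symm
  rw [← hsum, ← hsum {ω | X t ω = h}, Finset.sum_mul]
  refine Finset.sum_congr rfl fun c _ => ?_
  -- The default branch supplies the value at time `t` itself; later times are irrelevant.
  let H : ℕ → S → S := fun s => if hs : s < t then c ⟨s, hs⟩ else h
  have hHt : H t = h := by simp [H]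
  have hist : ∀ ω, (∀ s ≤ t, X s ω = H s) ↔ Y ω = c ∧ X t ω = h := by
    intro ω
    constructor
    · intro hω
      refine ⟨funext fun s => ?_, (hω t le_rfl).trans hHt⟩
      simpa [H] using hω s s.2.le
    · rintro ⟨h1, h2⟩ s hs
      rcases hs.lt_or_eq with hlt | rfl
      · simp only [H, dif_pos hlt]
        exact congrFun h1 ⟨s, hlt⟩
      · rw [h2, hHt]
  have hstep := hX.step t H g
  rw [hHt] at hstep
  simp only [hist] at hstep
  convert hstep using 2
  · ext ω
    simp [Set.mem_inter_iff, funext_iff, and_assoc]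
  · rfl

/-- If `h'` does not factor through `h`, the merge rule makes the left side vanish and the sum is
empty. -/
lemma real_step_eq_sum [Nonempty S] (hP : P ∈ Matrix.rowStochastic ℝ S)
    (hX : IsMergingSimulation P prob X) (t : ℕ) (h h' : S → S) :
    prob.real ({ω | X t ω = h} ∩ {ω | X (t + 1) ω = h'}) =
      prob.real {ω | X t ω = h} * ∑ g : S → S with g ∘ h = h', ∏ z, P z (g z) := by
  by_cases hg : ∃ g : S → S, h' = g ∘ h
  · obtain ⟨g, rfl⟩ := hg
    rw [sum_prod_filter_comp_eq hP, ← hX.real_step]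
    rfl
  · have h1 : {ω | X t ω = h} ∩ {ω | X (t + 1) ω = h'} = ∅ := by
      rw [Set.eq_empty_iff_forall_notMem]
      rintro ω ⟨h1, h2⟩
      refine hg ((Function.factorsThrough_iff h').1 fun i j hij => ?_)
      rw [← show X (t + 1) ω = h' from h2]
      exact hX.merge t ω i j (by rw [show X t ω = h from h1, hij])
    have h2 : (Finset.univ.filter fun g : S → S => g ∘ h = h') = ∅ :=
      Finset.filter_eq_empty_iff.2 fun g _ e => hg ⟨g, e.symm⟩
    rw [h1, h2]
    simp

lemma expect_succ [Nonempty S] (hP : P ∈ Matrix.rowStochastic ℝ S)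
    (hX : IsMergingSimulation P prob X) (t : ℕ) (φ : (S → S) → ℝ) :
    expect prob X (t + 1) φ = expect prob X t (mergingStep P φ) := by
  unfold expect mergingStep
  have h1 : ∀ h', prob.real {ω | X (t + 1) ω = h'} * φ h' = ∑ h : S → S,
      prob.real {ω | X t ω = h} * ∑ g : S → S with g ∘ h = h', (∏ z, P z (g z)) * φ (g ∘ h) := by
    intro h'
    rw [← hX.sum_real_inter_eq t, Finset.sum_mul]
    refine Finset.sum_congr rfl fun h _ => ?_
    rw [hX.real_step_eq_sum hP, mul_assoc, Finset.sum_mul]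
    congr 1
    refine Finset.sum_congr rfl fun g hg => ?_
    rw [(Finset.mem_filter.1 hg).2]
  simp only [h1]
  rw [Finset.sum_comm]
  refine Finset.sum_congr rfl fun h _ => ?_
  rw [← Finset.mul_sum, Finset.sum_fiberwise]

lemma expect_add [Nonempty S] (hP : P ∈ Matrix.rowStochastic ℝ S)
    (hX : IsMergingSimulation P prob X) (t s : ℕ) (φ : (S → S) → ℝ) :
    expect prob X (t + s) φ = expect prob X t ((mergingStep P)^[s] φ) := by
  induction s generalizing φ with
  | zero => rfl
  | succ s ih => rw [← add_assoc, expect_succ hP hX, ih, Function.iterate_succ_apply]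

lemma excess_add_le [Nonempty S] (hP : IsErgodicChain P) {μ : S → ℝ}
    (hμ : IsStationaryDistribution P μ) (hX : IsMergingSimulation P prob X) {T : ℕ}
    (hT : ∀ x, tvDistance ((P ^ T) x) μ ≤ 1 / 8) (t : ℕ) :
    excess prob X (t + T) ≤ excess prob X t - expect prob X t
      (fun h => (((Finset.univ.image h).card : ℝ) - 1) ^ 2) / (16 * Fintype.card S) := by
  have hPT := pow_mem hP.stochastic T
  have h1 : ∀ x, expect prob X t (avoidance P T x) ≤ expect prob X (t + T) (avoidance P 0 x) := by
    intro x
    rw [expect_add hP.stochastic hX]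
    exact expect_mono t (avoidance_le_mergingStep_iterate hP.stochastic T x)
  have h2 : ∀ s r, ∑ x, (1 - expect prob X s (avoidance P r x)) =
      expect prob X s fun h => ∑ x, (1 - avoidance P r x h) := by
    intro s r
    simp only [expect, Finset.mul_sum]
    rw [Finset.sum_comm]
    refine Finset.sum_congr rfl fun x _ => ?_
    simp only [mul_sub, mul_one, Finset.sum_sub_distrib, hX.sum_real_eq]
  have h3 : ∀ s (φ : (S → S) → ℝ), expect prob X s (fun h => φ h - 1) = expect prob X s φ - 1 := by
    intro s φ
    simp only [expect, mul_sub, mul_one, Finset.sum_sub_distrib, hX.sum_real_eq]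
  have h4 := Finset.sum_le_sum fun x (_ : x ∈ Finset.univ) => sub_le_sub_left (h1 x) 1
  rw [h2, h2] at h4
  simp only [sum_one_sub_avoidance_zero] at h4
  have h5 : expect prob X t (fun h => ∑ x, (1 - avoidance P T x h)) ≤
      expect prob X t fun h => ((Finset.univ.image h).card : ℝ) -
        (((Finset.univ.image h).card : ℝ) - 1) ^ 2 / (16 * Fintype.card S) :=
    expect_mono t fun h => sum_one_sub_prod_le (p := P ^ T)
      (fun _ _ => Matrix.nonneg_of_mem_rowStochastic hPT)
      (fun _ _ => Matrix.le_one_of_mem_rowStochastic hPT)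
      (Matrix.sum_row_of_mem_rowStochastic hPT) hμ.distribution.1 hμ.distribution.2
      (fun z => (sum_posPart_le_tvDistance _ _).trans (hT z)) _ (Finset.univ_nonempty.image h)
  have h6 : (expect prob X t fun h => ((Finset.univ.image h).card : ℝ) -
        (((Finset.univ.image h).card : ℝ) - 1) ^ 2 / (16 * Fintype.card S)) =
      expect prob X t (fun h => ((Finset.univ.image h).card : ℝ)) - expect prob X t
      (fun h => (((Finset.univ.image h).card : ℝ) - 1) ^ 2) / (16 * Fintype.card S) := by
    simp only [expect, mul_sub, Finset.sum_sub_distrib, Finset.sum_div, mul_div_assoc]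
  rw [excess, excess, h3, h3]
  linarith

/-- The variance is nonnegative. -/
lemma sq_excess_le_expect_sq (hX : IsMergingSimulation P prob X) (t : ℕ) :
    excess prob X t ^ 2 ≤
      expect prob X t fun h => (((Finset.univ.image h).card : ℝ) - 1) ^ 2 := by
  have h1 : 0 ≤ expect prob X t
      fun h => (((Finset.univ.image h).card : ℝ) - 1 - excess prob X t) ^ 2 :=
    Finset.sum_nonneg fun h _ => mul_nonneg measureReal_nonneg (sq_nonneg _)
  have h2 : ∀ e : ℝ, (expect prob X t
      fun h => (((Finset.univ.image h).card : ℝ) - 1 - e) ^ 2) =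
      (expect prob X t fun h => (((Finset.univ.image h).card : ℝ) - 1) ^ 2) -
        2 * e * excess prob X t + e ^ 2 * ∑ h : S → S, prob.real {ω | X t ω = h} := by
    intro e
    simp only [excess, expect, Finset.mul_sum]
    rw [← Finset.sum_sub_distrib, ← Finset.sum_add_distrib]
    exact Finset.sum_congr rfl fun h _ => by ring
  rw [h2, hX.sum_real_eq] at h1
  linarith

/-- Markov's inequality: `k - 1 ≥ 1` unless all simulations agree. -/
lemma one_sub_excess_le [Nonempty S] (hX : IsMergingSimulation P prob X) (t : ℕ) :
    1 - excess prob X t ≤ prob.real {ω | ∀ i j : S, X t ω i = X t ω j} := by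
  classical
  have h1 := sum_measureReal_preimage_singleton (μ := prob)
    (Finset.univ.filter fun h : S → S => ∀ i j, h i = h j) (f := X t)
    fun h _ => hX.measurableSet_eq t h
  have h2 : X t ⁻¹' (Finset.univ.filter fun h : S → S => ∀ i j, h i = h j : Finset (S → S)) =
      {ω | ∀ i j : S, X t ω i = X t ω j} := by
    ext ω; simp
  rw [h2] at h1
  rw [← h1, Finset.sum_filter, ← hX.sum_real_eq t, excess, expect, ← Finset.sum_sub_distrib]
  refine Finset.sum_le_sum fun h _ => ?_
  change _ ≤ if _ then prob.real {ω | X t ω = h} else 0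
  have h3 : 0 ≤ prob.real {ω | X t ω = h} := measureReal_nonneg
  have h4 := one_le_card_image h
  split_ifs with hc
  · nlinarith
  · have h5 : (2 : ℝ) ≤ (Finset.univ.image h).card := by
      push Not at hc
      obtain ⟨i, j, hij⟩ := hc
      exact_mod_cast Finset.one_lt_card.2 ⟨h i, Finset.mem_image_of_mem h (Finset.mem_univ i),
        h j, Finset.mem_image_of_mem h (Finset.mem_univ j), hij⟩
    nlinarith

/-- After `16 |S| + m` mixing times the expected number of missing mergers is exponentially
small. -/
lemma excess_le_exp [Nonempty S] (hP : IsErgodicChain P) {μ : S → ℝ}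
    (hμ : IsStationaryDistribution P μ) (hX : IsMergingSimulation P prob X) (m : ℕ) :
    excess prob X ((16 * Fintype.card S + m) * mixingTime P μ) ≤
      Real.exp (-(m / (16 * Fintype.card S : ℕ))) := by
  have hn : (0 : ℝ) ≤ 16 * Fintype.card S := by positivity
  refine le_exp_of_quadratic_decay (w := fun r => excess prob X (r * mixingTime P μ))
    (by have := Fintype.card_pos (α := S); omega) (fun r => excess_nonneg _) (fun r => ?_)
    (fun r => ?_) m
  all_goals
    have h1 := excess_add_le hP hμ hX (hP.tvDistance_mixingTime_le hμ) (r * mixingTime P μ)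
    simp only [add_mul, one_mul]
    push_cast
    refine h1.trans (sub_le_sub_left (div_le_div_of_nonneg_right ?_ hn) _)
  · exact hX.sq_excess_le_expect_sq _
  · exact excess_le_expect_sq _

end IsMergingSimulation

theorem theorem3 {S : Type*} [Fintype S] [DecidableEq S] [Nonempty S]
    (P : Matrix S S ℝ) (hP : IsErgodicChain P)
    (μ : S → ℝ) (hμ : IsStationaryDistribution P μ)
    {Ω : Type*} [MeasurableSpace Ω] (prob : Measure Ω) [IsProbabilityMeasure prob]
    (X : ℕ → Ω → S → S) (hX : IsMergingSimulation P prob X)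
    (δ : ℝ) (hδ : 0 < δ) (hδ' : δ ≤ 1 / 2) :
    1 - δ ≤ prob.real {ω | ∃ t : ℕ,
      (t : ℝ) ≤ 512 * (Fintype.card S : ℝ) * (mixingTime P μ : ℝ) * Real.log (1 / δ) ∧
        ∀ i j : S, X t ω i = X t ω j} := by
  set n : ℕ := Fintype.card S with hn
  set T := mixingTime P μ
  set L := Real.log (1 / δ) with hL
  have hL2 : 69 / 100 ≤ L := by
    have h1 : Real.log 2 ≤ L :=
      Real.log_le_log two_pos (by rw [le_div_iff₀ hδ]; linarith)
    linarith [Real.log_two_gt_d9]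
  have hn1 : (1 : ℝ) ≤ n := by exact_mod_cast Fintype.card_pos (α := S)
  have hnL : 69 / 100 * (n : ℝ) ≤ n * L := by nlinarith
  -- The number of whole blocks. Beyond the first `16 n`, decay to `δ` needs `m ≥ 16 n L`; since `δ
  -- ≤ 1 / 2` bounds `L` below, 512 leaves ample room for this and the rounding.
  set r := ⌊512 * (n : ℝ) * L⌋₊ with hr
  have hr1 : (r : ℝ) ≤ 512 * n * L := Nat.floor_le (by positivity)
  have hr2 : 512 * (n : ℝ) * L < r + 1 := Nat.lt_floor_add_one _
  have hr3 : 16 * n ≤ r := Nat.le_floor (by push_cast; linarith)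
  obtain ⟨m, hm⟩ := Nat.exists_eq_add_of_le hr3
  have hmr : (r : ℝ) = 16 * n + m := by exact_mod_cast hm
  have hexp : Real.exp (-((m : ℝ) / (16 * n : ℕ))) ≤ δ := by
    have h1 : Real.exp (-L) = δ := by
      rw [hL, one_div, Real.log_inv, neg_neg, Real.exp_log hδ]
    rw [← h1]
    refine Real.exp_le_exp.2 (neg_le_neg ?_)
    push_cast
    rw [le_div_iff₀ (by positivity)]
    nlinarith
  have hexc := (hX.excess_le_exp hP hμ m).trans hexp
  rw [← hm] at hexc
  refine (sub_le_sub_left hexc 1).trans ((hX.one_sub_excess_le _).trans ?_)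
  refine measureReal_mono fun ω hω => ⟨r * T, ?_, hω⟩
  push_cast
  calc (r : ℝ) * T ≤ 512 * n * L * T := mul_le_mul_of_nonneg_right hr1 (Nat.cast_nonneg _)
    _ = 512 * n * T * L := by ring
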